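/- Let $F$ be a distribution function on $\mathbb R$ with tail $\overline F=1-F$, and write $\hat F(\gamma)=\int_{\mathbb R} e^{\gamma x}\,dF(x)\in[0,\infty]$. Say that $F\in\mathcal L(\gamma)$ if $\overline F(x)>0$ for all $x$ and $\overline F(x-k)/\overline F(x)\to e^{\gamma k}$ as $x\to\infty$ for every fixed $k\in\mathbb R$, and that $F\in\mathcal S(\gamma)$ if $F\in\mathcal L(\gamma)$, $\hat F(\gamma)<\infty$ and $\overline{F^{*2}}(x)\sim 2\hat F(\gamma)\overline F(x)$ as $x\to\infty$, where $F^{*2}$ is the convolution of $F$ with itself. Let $\xi_1,\xi_2,\dots$ be independent random variables with distribution function $F$, let $S_0=0$, $S_n=\xi_1+\dots+\xi_n$, $M_N=\max_{0\le i\le N}S_i$ for $0\le N<\infty$, and $M=M_\infty=\sup_{n\ge0}S_n$. For $n\ge1$ put $A_n^{a,x}=\{M_{n-1}\le a,\ S_n>x\}$. **Theorem.** Suppose that $F\in\mathcal S(\gamma)$ for some $\gamma>0$ and that $\hat F(\gamma)<1$. For $1\le N\le\infty$ let $$c_N=\sum_{n=1}^{N}\hat F(\gamma)^{n-1}\,\mathbf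 E e^{\gamma M_{N-n}},$$ where for $N=\infty$ this is read with $M_{\infty-n}=M$, i.e. $c_\infty=\sum_{n\ge1}\hat F(\gamma)^{n-1}\mathbf E e^{\gamma M}=\mathbf E e^{\gamma M}/(1-\hat F(\gamma))$. Then $c_N<\infty$ for all $1\le N\le\infty$, and for every function $h:(0,\infty)\to(0,\infty)$ with $h(x)\le x/2$ for all $x>0$ and $h(x)\to\infty$ as $x\to\infty$, $$\lim_{x\to\infty}\frac{1}{\overline F(x)}\,\mathbf P\Bigl(M_N>x,\ \bigcup_{n\ge 1,\ n\le N}A_n^{h(x),\,x-h(x)}\Bigr)=\lim_{x\to\infty}\frac{\mathbf P(M_N>x)}{\overline F(x)}=c_N ,$$ where $n$ ranges over finite integers and both convergences are uniform over all $1\le N\le\infty$. Moreover, for every $\varepsilon>0$ there is a finite $N\ge1$ such that $\lim_{x\to\infty}\mathbf P(M_N>x\mid M>x)$ exists and is greater than $1-\varepsilon$. -/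

import Mathlib

open MeasureTheory ProbabilityTheory Filter Topology
open scoped ENNReal

noncomputable section

namespace GammaWalk

/-- The tail `1 - F` of the distribution function `F` of a probability measure on the line. -/
def tail (μ : Measure ℝ) (x : ℝ) : ℝ := 1 - cdf μ x

/-- The exponential moment `∫ e^{α x} dF(x)`, with values in `[0, ∞]`. -/
def expMoment (μ : Measure ℝ) (α : ℝ) : ℝ≥0∞ := ∫⁻ x, ENNReal.ofReal (Real.exp (α * x)) ∂μ

/-- The class `L(γ)`. -/
structure ClassL (γ : ℝ) (μ : Measure ℝ) : Prop where
  tail_pos : ∀ x : ℝ, 0 < tail μ x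
  tendsto_shift : ∀ k : ℝ,
    Tendsto (fun x : ℝ => tail μ (x - k) / tail μ x) atTop (𝓝 (Real.exp (γ * k)))

/-- The class `S(γ)`: members of `L(γ)` with finite exponential moment at `γ` whose two-fold
convolution has a tail equivalent to `2 φ(γ)` times the tail. -/
structure ClassS (γ : ℝ) (μ : Measure ℝ) : Prop extends ClassL γ μ where
  expMoment_lt_top : expMoment μ γ < ∞
  tendsto_conv : Tendsto
    (fun x : ℝ => tail (Measure.conv μ μ) x / (2 * (expMoment μ γ).toReal * tail μ x))
    atTop (𝓝 1)

variable {Ω : Type*}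

/-- The random walk `S_n = ξ_1 + ⋯ + ξ_n`; the increment `ξ_{i+1}` is `ξ i`. -/
def walk (ξ : ℕ → Ω → ℝ) (n : ℕ) (ω : Ω) : ℝ := ∑ i ∈ Finset.range n, ξ i ω

/-- `M_N = sup {S_n : 0 ≤ n ≤ N}` for `N ≤ ∞`; for `N = ∞` this is the all-time supremum `M`. -/
def walkMax (ξ : ℕ → Ω → ℝ) (N : ℕ∞) (ω : Ω) : EReal :=
  ⨆ (n : ℕ) (_ : (n : ℕ∞) ≤ N), (walk ξ n ω : EReal)

/-- The event `A_n^{a,x} = {M_{n-1} ≤ a, S_n > x}`, for `n ≥ 1`. -/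
def jumpEvent (ξ : ℕ → Ω → ℝ) (n : ℕ) (a x : ℝ) : Set Ω :=
  {ω | walkMax ξ ((n - 1 : ℕ) : ℕ∞) ω ≤ (a : EReal) ∧ x < walk ξ n ω}

/-- The event `M_N > x`. -/
def exceedEvent (ξ : ℕ → Ω → ℝ) (N : ℕ∞) (x : ℝ) : Set Ω :=
  {ω | (x : EReal) < walkMax ξ N ω}

/-- The event that `A_n^{a,x}` occurs for some finite `n` with `1 ≤ n ≤ N`. -/
def someJumpEvent (ξ : ℕ → Ω → ℝ) (N : ℕ∞) (a x : ℝ) : Set Ω :=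
  ⋃ (n : ℕ) (_ : 1 ≤ n ∧ (n : ℕ∞) ≤ N), jumpEvent ξ n a x

/-- The expectation `E e^{γ M_N}`, with values in `[0, ∞]`. -/
def maxExpMoment [MeasurableSpace Ω] (P : Measure Ω) (ξ : ℕ → Ω → ℝ) (γ : ℝ) (N : ℕ∞) : ℝ≥0∞ :=
  ∫⁻ ω, EReal.exp ((γ : EReal) * walkMax ξ N ω) ∂P

/-- The constant `∑_{n=1}^N φ(γ)^{n-1} E e^{γ M_{N-n}}` for `N ≤ ∞` (with `∞ - n = ∞`). -/
def limitConst [MeasurableSpace Ω] (P : Measure Ω) (ξ : ℕ → Ω → ℝ) (μ : Measure ℝ) (γ : ℝ)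
    (N : ℕ∞) : ℝ≥0∞ :=
  ∑' n : {n : ℕ // 1 ≤ n ∧ (n : ℕ∞) ≤ N},
    expMoment μ γ ^ ((n : ℕ) - 1) * maxExpMoment P ξ γ (N - ((n : ℕ) : ℕ∞))

/-- For finite `N` the constant is the finite sum. -/
theorem limitConst_coe [MeasurableSpace Ω] (P : Measure Ω) (ξ : ℕ → Ω → ℝ) (μ : Measure ℝ)
    (γ : ℝ) (N : ℕ) :
    limitConst P ξ μ γ N =
      ∑ n ∈ Finset.Icc 1 N, expMoment μ γ ^ (n - 1) * maxExpMoment P ξ γ ((N - n : ℕ) : ℕ∞) := by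
  rw [← Finset.tsum_subtype]
  let e : {n : ℕ // 1 ≤ n ∧ (n : ℕ∞) ≤ (N : ℕ∞)} ≃ {n : ℕ // n ∈ Finset.Icc 1 N} :=
    Equiv.subtypeEquivRight fun n => by simp
  exact e.tsum_eq (fun n => expMoment μ γ ^ ((n : ℕ) - 1) *
    maxExpMoment P ξ γ ((N - (n : ℕ) : ℕ) : ℕ∞))

/-- For `N = ∞` the constant is `E e^{γ M} / (1 - φ(γ))`. -/
theorem limitConst_top [MeasurableSpace Ω] (P : Measure Ω) (ξ : ℕ → Ω → ℝ) (μ : Measure ℝ)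
    (γ : ℝ) :
    limitConst P ξ μ γ ⊤ = maxExpMoment P ξ γ ⊤ / (1 - expMoment μ γ) := by
  let e : ℕ ≃ {n : ℕ // 1 ≤ n ∧ (n : ℕ∞) ≤ (⊤ : ℕ∞)} :=
    { toFun := fun n => ⟨n + 1, by simp⟩
      invFun := fun n => n - 1
      left_inv := fun n => by simp
      right_inv := fun n => Subtype.ext (Nat.sub_add_cancel n.2.1) }
  unfold limitConst
  rw [← e.tsum_eq, div_eq_mul_inv, ← ENNReal.tsum_geometric, mul_comm, ← ENNReal.tsum_mul_right]
  refine tsum_congr fun n => ?_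
  have hn : (⊤ : ℕ∞) - ((n + 1 : ℕ) : ℕ∞) = ⊤ := ENat.top_sub_natCast (n + 1)
  simp only [e, Equiv.coe_fn_mk, hn, Nat.add_sub_cancel]

/-- Truncation levels: positive functions `h` on `(0, ∞)` with `h(x) ≤ x / 2` and
`h(x) → ∞` as `x → ∞` (values of `h` outside `(0, ∞)` play no role). -/
structure IsTruncation (h : ℝ → ℝ) : Prop where
  pos : ∀ x : ℝ, 0 < x → 0 < h x
  le_half : ∀ x : ℝ, 0 < x → h x ≤ x / 2
  tendsto_atTop : Tendsto h atTop atTop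

end GammaWalk

end

open GammaWalk

/-! Write φ for the exponential moment of `μ` at γ. Removing the first increment shows that M_{N+1}
has the law of max(0, ξ + M_N) with ξ and M_N independent, so for x ≥ 0 its tail is that of a
convolution with `μ`. If a law ν has tail asymptotic to c times that of `μ`, and γ-moment m < ∞,
then `μ.conv ν` has tail constant cφ + m (`ClassS.tendsto_tail_conv_of_tendsto`). Hence the
constants obey c_{N+1} = φ c_N + E e^{γ M_N}, which is `limitConst_succ`; this settles each finite
N.

Uniformity in N, including N = ∞, comes from a Kesten-type bound P(S_n > x) ≤ a_n · `tail μ x` for x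
≥ A with Σ a_n < ∞ (`ClassS.exists_summable_tail_walkLaw_le`): times beyond a large n₀ contribute
little for every N at once. Here φ < 1 is what makes the recursion for a_n contract.

For the jump events, suppose the walk passes x by time n₀ but no jump event occurs. At its first
passage above h(x) it lies in (h(x), x - h(x)], so two independent blocks both exceed h(x) and sum
to more than x. By the definition of S(γ) this has probability o(`tail μ x`) as h(x) → ∞. The
conditional limit is c_N / c_∞, which tends to 1. -/

namespace GammaWalk

/-! ### Tails of convolutions in S(γ). -/

section Tail

variable {γ : ℝ} {μ ν ρ : Measure ℝ} [IsProbabilityMeasure μ] [IsProbabilityMeasure ν]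
  [IsProbabilityMeasure ρ]

theorem tail_eq_real (μ : Measure ℝ) [IsProbabilityMeasure μ] (x : ℝ) :
    tail μ x = μ.real (Set.Ioi x) := by
  rw [tail, cdf_eq_real, ← Set.compl_Iic, probReal_compl_eq_one_sub measurableSet_Iic]

theorem tail_nonneg (μ : Measure ℝ) [IsProbabilityMeasure μ] (x : ℝ) : 0 ≤ tail μ x := by
  rw [tail_eq_real]; exact measureReal_nonneg

theorem tail_le_one (μ : Measure ℝ) [IsProbabilityMeasure μ] (x : ℝ) : tail μ x ≤ 1 := by
  rw [tail_eq_real]; exact measureReal_le_one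

theorem tail_antitone (μ : Measure ℝ) [IsProbabilityMeasure μ] : Antitone (tail μ) :=
  fun _ _ h => sub_le_sub_left (monotone_cdf μ h) 1

theorem measurable_tail (μ : Measure ℝ) [IsProbabilityMeasure μ] : Measurable (tail μ) :=
  (tail_antitone μ).measurable

theorem measurable_tail_sub (μ : Measure ℝ) [IsProbabilityMeasure μ] (x : ℝ) :
    Measurable fun y => tail μ (x - y) :=
  (measurable_tail μ).comp (measurable_const.sub measurable_id)

theorem integrable_tail_comp (ν ρ : Measure ℝ) [IsProbabilityMeasure ν] [IsFiniteMeasure ρ]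
    {f : ℝ → ℝ} (hf : Measurable f) : Integrable (fun y => tail ν (f y)) ρ := by
  refine Integrable.of_bound ((measurable_tail ν).comp hf).aestronglyMeasurable 1 (.of_forall ?_)
  intro y
  rw [Real.norm_of_nonneg (tail_nonneg ν _)]
  exact tail_le_one ν _

/-- Dominated convergence: for y ≤ K the integrand is largest at y = K, where the ratio converges
and so is eventually bounded. -/
theorem ClassL.tendsto_setIntegral (hL : ClassL γ μ) {c : ℝ}
    (hν : Tendsto (fun x => tail ν x / tail μ x) atTop (𝓝 c)) (K : ℝ) :
    Tendsto (fun x => (∫ y in Set.Iic K, tail ν (x - y) ∂ρ) / tail μ x) atTop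
      (𝓝 (c * ∫ y in Set.Iic K, Real.exp (γ * y) ∂ρ)) := by
  have key : ∀ y, Tendsto (fun x => tail ν (x - y) / tail μ x) atTop
      (𝓝 (c * Real.exp (γ * y))) := by
    intro y
    have h1 : Tendsto (fun x => tail ν (x - y) / tail μ (x - y)) atTop (𝓝 c) :=
      hν.comp (tendsto_atTop_add_const_right _ (-y) tendsto_id)
    refine (h1.mul (hL.tendsto_shift y)).congr fun x => ?_
    have := (hL.tail_pos (x - y)).ne'
    field_simp
  rw [← integral_const_mul]
  simp_rw [← integral_div]
  refine tendsto_integral_filter_of_dominated_convergence (fun _ => c * Real.exp (γ * K) + 1)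
    (.of_forall fun x => ?_) ?_ (integrable_const _) (.of_forall key)
  · exact ((measurable_tail_sub ν x).div_const _).aestronglyMeasurable
  · filter_upwards [(key K).eventually (gt_mem_nhds (lt_add_one _))] with x hx
    filter_upwards [ae_restrict_mem measurableSet_Iic] with y hy
    rw [Real.norm_of_nonneg (div_nonneg (tail_nonneg _ _) (tail_nonneg _ _))]
    refine le_trans ?_ hx.le
    exact div_le_div_of_nonneg_right (tail_antitone ν (sub_le_sub_left hy x)) (tail_nonneg μ x)

/-- The probability that two independent variables both exceed `K` and their sum exceeds `x`. -/
noncomputable def jointTail (μ ν : Measure ℝ) (K x : ℝ) : ℝ :=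
  (μ.prod ν).real {p | K < p.1 ∧ K < p.2 ∧ x < p.1 + p.2}

theorem measureReal_prod_eq_integral (μ ν : Measure ℝ) [IsProbabilityMeasure μ]
    [IsProbabilityMeasure ν] {s : Set (ℝ × ℝ)} (hs : MeasurableSet s) :
    (μ.prod ν).real s = ∫ y, ν.real (Prod.mk y ⁻¹' s) ∂μ := by
  simp only [measureReal_def]
  rw [Measure.prod_apply hs, integral_toReal (measurable_measure_prodMk_left hs).aemeasurable]
  exact .of_forall fun y => measure_lt_top _ _

theorem measureReal_prod_fst_le (μ ν : Measure ℝ) [IsProbabilityMeasure μ]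
    [IsProbabilityMeasure ν] (K x : ℝ) :
    (μ.prod ν).real {p | p.1 ≤ K ∧ x < p.1 + p.2} = ∫ y in Set.Iic K, tail ν (x - y) ∂μ := by
  rw [measureReal_prod_eq_integral, ← integral_indicator measurableSet_Iic]
  · refine integral_congr_ae (.of_forall fun y => ?_)
    by_cases hy : y ≤ K
    · simp only [Set.preimage_ofPred_eq, hy, true_and, Set.indicator_of_mem (Set.mem_Iic.2 hy),
        tail_eq_real]
      congr 1; ext z; simp [sub_lt_iff_lt_add']
    · simp [hy]
  · measurability

theorem measureReal_prod_snd_le (μ ν : Measure ℝ) [IsProbabilityMeasure μ]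
    [IsProbabilityMeasure ν] (K x : ℝ) :
    (μ.prod ν).real {p | p.2 ≤ K ∧ x < p.1 + p.2} = ∫ y in Set.Iic K, tail μ (x - y) ∂ν := by
  rw [← measureReal_prod_fst_le ν μ, ← Measure.prod_swap, map_measureReal_apply measurable_swap]
  · congr 1; ext p; simp [add_comm]
  · measurability

theorem tail_conv (μ ν : Measure ℝ) [IsProbabilityMeasure μ] [IsProbabilityMeasure ν] (x : ℝ) :
    tail (μ.conv ν) x = (μ.prod ν).real {p | x < p.1 + p.2} := by
  rw [tail_eq_real, Measure.conv, map_measureReal_apply (by fun_prop) measurableSet_Ioi]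
  rfl

/-- Both variables cannot be at most K when the sum exceeds x ≥ 2K, so exactly three disjoint cases
remain. -/
theorem tail_conv_eq (μ ν : Measure ℝ) [IsProbabilityMeasure μ] [IsProbabilityMeasure ν]
    {K x : ℝ} (hx : 2 * K ≤ x) :
    tail (μ.conv ν) x = (∫ y in Set.Iic K, tail ν (x - y) ∂μ) +
      (∫ y in Set.Iic K, tail μ (x - y) ∂ν) + jointTail μ ν K x := by
  rw [tail_conv, jointTail, ← measureReal_prod_fst_le, ← measureReal_prod_snd_le,
    ← measureReal_union, ← measureReal_union]
  · congr 1
    ext p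
    simp only [Set.mem_ofPred_eq, Set.mem_union]
    grind
  · rw [Set.disjoint_left]; rintro p (h | h) h' <;> simp only [Set.mem_ofPred_eq] at h h' <;> grind
  · measurability
  · rw [Set.disjoint_left]; rintro p h h'; simp only [Set.mem_ofPred_eq] at h h'; grind
  · measurability

theorem jointTail_nonneg (μ ν : Measure ℝ) (K x : ℝ) : 0 ≤ jointTail μ ν K x :=
  measureReal_nonneg

/-- Only the tail of `ν` on [K, ∞) enters, so a tail bound valid from K onwards transfers to
`jointTail`. -/
theorem jointTail_eq_integral (μ ν : Measure ℝ) [IsProbabilityMeasure μ]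
    [IsProbabilityMeasure ν] (K x : ℝ) :
    jointTail μ ν K x = ∫ y in Set.Ioi K, tail ν (max K (x - y)) ∂μ := by
  rw [jointTail, measureReal_prod_eq_integral, ← integral_indicator measurableSet_Ioi]
  · refine integral_congr_ae (.of_forall fun y => ?_)
    by_cases hy : K < y
    · simp only [Set.preimage_ofPred_eq, hy, true_and, Set.indicator_of_mem (Set.mem_Ioi.2 hy),
        tail_eq_real]
      congr 1; ext z; simp [sub_lt_iff_lt_add']
    · simp [hy]
  · measurability

theorem jointTail_comm (μ ν : Measure ℝ) [IsProbabilityMeasure μ]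
    [IsProbabilityMeasure ν] (K x : ℝ) : jointTail μ ν K x = jointTail ν μ K x := by
  rw [jointTail, jointTail, ← Measure.prod_swap, map_measureReal_apply measurable_swap]
  · congr 1; ext p; simp [add_comm, and_left_comm]
  · measurability

theorem jointTail_mono_right {C K : ℝ} (h : ∀ z, K ≤ z → tail ν z ≤ C * tail ρ z) (x : ℝ) :
    jointTail μ ν K x ≤ C * jointTail μ ρ K x := by
  rw [jointTail_eq_integral, jointTail_eq_integral, ← integral_const_mul]
  have hm : Measurable fun y => max K (x - y) := by fun_prop
  refine integral_mono (integrable_tail_comp ν _ hm) ((integrable_tail_comp ρ _ hm).const_mul C) ?_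
  exact fun y => h _ (le_max_left _ _)

theorem jointTail_mono_left {C K : ℝ} (h : ∀ z, K ≤ z → tail ν z ≤ C * tail ρ z) (x : ℝ) :
    jointTail ν μ K x ≤ C * jointTail ρ μ K x := by
  rw [jointTail_comm ν, jointTail_comm ρ]
  exact jointTail_mono_right h x

theorem jointTail_antitone (μ ν : Measure ℝ) [IsProbabilityMeasure μ]
    [IsProbabilityMeasure ν] (x : ℝ) : Antitone fun K => jointTail μ ν K x :=
  fun _ _ h => measureReal_mono fun _ hp => ⟨h.trans_lt hp.1, h.trans_lt hp.2.1, hp.2.2⟩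

omit [IsProbabilityMeasure ν] in
theorem integrable_exp_of_expMoment_lt_top (h : expMoment ν γ < ∞) :
    Integrable (fun y => Real.exp (γ * y)) ν := by
  refine ⟨by fun_prop, ?_⟩
  rw [hasFiniteIntegral_iff_ofReal (.of_forall fun y => (Real.exp_pos _).le)]
  exact h

theorem integral_exp_eq (ν : Measure ℝ) (γ : ℝ) :
    ∫ y, Real.exp (γ * y) ∂ν = (expMoment ν γ).toReal := by
  rw [integral_eq_lintegral_of_nonneg_ae (.of_forall fun y => (Real.exp_pos _).le) (by fun_prop)]
  rfl

omit [IsProbabilityMeasure ν] in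
theorem tendsto_setIntegral_exp (h : expMoment ν γ < ∞) :
    Tendsto (fun K => ∫ y in Set.Iic K, Real.exp (γ * y) ∂ν) atTop
      (𝓝 (expMoment ν γ).toReal) := by
  rw [← integral_exp_eq ν γ, ← setIntegral_univ (μ := ν), ← iUnion_Iic_of_not_bddAbove_range (f := id)]
  · exact tendsto_setIntegral_of_monotone (fun _ => measurableSet_Iic)
      (fun a b h => Set.Iic_subset_Iic.2 h) (integrable_exp_of_expMoment_lt_top h).integrableOn
  · simp [not_bddAbove_univ]

theorem expMoment_toReal_pos (h : expMoment ν γ < ∞) : 0 < (expMoment ν γ).toReal := by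
  rw [← integral_exp_eq ν γ]
  exact integral_exp_pos (integrable_exp_of_expMoment_lt_top h)

theorem ClassS.tendsto_tail_conv (hS : ClassS γ μ) :
    Tendsto (fun x => tail (μ.conv μ) x / tail μ x) atTop
      (𝓝 (2 * (expMoment μ γ).toReal)) := by
  have hp := expMoment_toReal_pos hS.expMoment_lt_top
  have := hS.tendsto_conv.const_mul (2 * (expMoment μ γ).toReal)
  rw [mul_one] at this
  refine this.congr fun x => ?_
  have := (hS.tail_pos x).ne'
  field_simp

theorem ClassL.tendsto_setIntegral_self (hL : ClassL γ μ) (K : ℝ) :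
    Tendsto (fun x => (∫ y in Set.Iic K, tail μ (x - y) ∂ρ) / tail μ x) atTop
      (𝓝 (∫ y in Set.Iic K, Real.exp (γ * y) ∂ρ)) := by
  have h : Tendsto (fun x => tail μ x / tail μ x) atTop (𝓝 1) :=
    tendsto_const_nhds.congr fun x => (div_self (hL.tail_pos x).ne').symm
  simpa using hL.tendsto_setIntegral (ρ := ρ) h K

/-- Subtract the two one-variable-bounded terms of `tail_conv_eq` from the limit 2φ of the full
convolution tail. The remainder vanishes as K → ∞. -/
theorem ClassS.tendsto_jointTail (hS : ClassS γ μ) (K : ℝ) :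
    Tendsto (fun x => jointTail μ μ K x / tail μ x) atTop
      (𝓝 (2 * ((expMoment μ γ).toReal - ∫ y in Set.Iic K, Real.exp (γ * y) ∂μ))) := by
  have hI := hS.tendsto_setIntegral_self (ρ := μ) K
  have := (hS.tendsto_tail_conv.sub hI).sub hI
  rw [show ∀ a b : ℝ, 2 * (a - b) = 2 * a - b - b by intros; ring]
  refine this.congr' ?_
  filter_upwards [eventually_ge_atTop (2 * K)] with x hx
  rw [tail_conv_eq μ μ hx]
  ring

theorem ClassS.eventually_jointTail_le (hS : ClassS γ μ) {ε : ℝ} (hε : 0 < ε) :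
    ∃ K₀, ∀ K, K₀ ≤ K → ∀ᶠ x in atTop, jointTail μ μ K x ≤ ε * tail μ x := by
  have h := ((tendsto_setIntegral_exp hS.expMoment_lt_top).const_sub
    (expMoment μ γ).toReal).const_mul 2
  rw [sub_self, mul_zero] at h
  obtain ⟨K₀, hK₀⟩ := eventually_atTop.1 (h.eventually (gt_mem_nhds hε))
  refine ⟨K₀, fun K hK => ?_⟩
  filter_upwards [(hS.tendsto_jointTail K).eventually (gt_mem_nhds (hK₀ K hK))] with x hx
  exact ((div_lt_iff₀ (hS.tail_pos x)).1 hx).le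

theorem ClassL.exists_tail_le (hL : ClassL γ μ) {c : ℝ}
    (hν : Tendsto (fun x => tail ν x / tail μ x) atTop (𝓝 c)) :
    ∃ C, 0 ≤ C ∧ ∀ z, tail ν z ≤ C * tail μ z := by
  obtain ⟨x₀, hx₀⟩ := eventually_atTop.1 (hν.eventually (gt_mem_nhds (lt_add_one c)))
  have hp := hL.tail_pos x₀
  refine ⟨max (c + 1) (1 / tail μ x₀), le_max_of_le_right (by positivity), fun z => ?_⟩
  rcases le_total x₀ z with hz | hz
  · refine ((div_lt_iff₀ (hL.tail_pos z)).1 (hx₀ z hz)).le.trans ?_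
    exact mul_le_mul_of_nonneg_right (le_max_left _ _) (tail_nonneg _ _)
  · refine (tail_le_one ν z).trans ?_
    refine le_trans ?_ (mul_le_mul_of_nonneg_right (le_max_right _ _) (tail_nonneg _ _))
    rw [one_div_mul_eq_div, le_div_iff₀ hp, one_mul]
    exact tail_antitone μ hz

/-- The tail of the convolution of a member of `S(γ)` with a law whose tail is comparable. -/
theorem ClassS.tendsto_tail_conv_of_tendsto (hS : ClassS γ μ) {c : ℝ}
    (hν : Tendsto (fun x => tail ν x / tail μ x) atTop (𝓝 c)) (hm : expMoment ν γ < ∞) :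
    Tendsto (fun x => tail (μ.conv ν) x / tail μ x) atTop
      (𝓝 (c * (expMoment μ γ).toReal + (expMoment ν γ).toReal)) := by
  obtain ⟨C, hC, hdom⟩ := hS.exists_tail_le hν
  rw [Metric.tendsto_atTop']
  intro ε hε
  -- Order of limits: K is fixed first, making both the joint tail and the truncated moments
  -- accurate, and only then x grows. The `C + 1` guards against `C = 0`.
  obtain ⟨K₀, hK₀⟩ := hS.eventually_jointTail_le (ε := ε / (3 * (C + 1))) (by positivity)
  have hlim := ((tendsto_setIntegral_exp hS.expMoment_lt_top).const_mul c).add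
    (tendsto_setIntegral_exp hm)
  obtain ⟨K, hK, hd⟩ := ((eventually_ge_atTop K₀).and
    (hlim.eventually (Metric.ball_mem_nhds _ (by positivity : 0 < ε / 3)))).exists
  have hsum := (hS.tendsto_setIntegral (ρ := μ) hν K).add (hS.tendsto_setIntegral_self (ρ := ν) K)
  obtain ⟨x₀, hx₀⟩ := eventually_atTop.1 (((hK₀ K hK).and (eventually_ge_atTop (2 * K))).and
    (hsum.eventually (Metric.ball_mem_nhds _ (by positivity : 0 < ε / 3))))
  refine ⟨x₀, fun x hx => ?_⟩
  obtain ⟨⟨hJ, hxK⟩, hs⟩ := hx₀ x hx.le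
  have hp := hS.tail_pos x
  have hJ' : jointTail μ ν K x / tail μ x < ε / 3 := by
    rw [div_lt_iff₀ hp]
    calc jointTail μ ν K x ≤ C * jointTail μ μ K x := jointTail_mono_right (fun z _ => hdom z) x
      _ ≤ C * (ε / (3 * (C + 1)) * tail μ x) := mul_le_mul_of_nonneg_left hJ hC
      _ = C / (C + 1) * (ε / 3 * tail μ x) := by field_simp
      _ < 1 * (ε / 3 * tail μ x) := by
        refine mul_lt_mul_of_pos_right ?_ (by positivity)
        rw [div_lt_one (by positivity)]; linarith
      _ = _ := one_mul _
  have hJ0 : 0 ≤ jointTail μ ν K x / tail μ x := div_nonneg (jointTail_nonneg _ _ _ _) hp.le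
  rw [Real.dist_eq, tail_conv_eq μ ν hxK, add_div, add_div]
  simp only [Real.dist_eq] at hd hs
  rw [abs_lt] at *
  constructor <;> linarith [hd.1, hd.2, hs.1, hs.2]

end Tail


/-! ### Summable Kesten-type bounds for the tails of S_n. -/

section Kesten

variable {γ β : ℝ} {μ ν ρ : Measure ℝ} [IsProbabilityMeasure μ] [IsProbabilityMeasure ν]

theorem expMoment_conv (μ ν : Measure ℝ) [IsProbabilityMeasure μ] [IsProbabilityMeasure ν]
    (α : ℝ) : expMoment (μ.conv ν) α = expMoment μ α * expMoment ν α := by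
  unfold expMoment
  rw [Measure.lintegral_conv (by fun_prop), ← lintegral_mul_const _ (by fun_prop)]
  refine lintegral_congr fun x => ?_
  rw [← lintegral_const_mul _ (by fun_prop)]
  refine lintegral_congr fun y => ?_
  rw [mul_add, Real.exp_add, ENNReal.ofReal_mul (Real.exp_pos _).le]

/-- Integrate 2e^{γx/2} ≤ e^{γx} + 1. -/
theorem expMoment_half_lt_one (h : expMoment μ γ < 1) : expMoment μ (γ / 2) < 1 := by
  have key : 2 * expMoment μ (γ / 2) ≤ expMoment μ γ + 1 := by
    unfold expMoment
    rw [← lintegral_const_mul _ (by fun_prop)]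
    calc ∫⁻ x, 2 * ENNReal.ofReal (Real.exp (γ / 2 * x)) ∂μ
        ≤ ∫⁻ x, (ENNReal.ofReal (Real.exp (γ * x)) + 1) ∂μ := by
          refine lintegral_mono fun x => ?_
          rw [← ENNReal.ofReal_one, ← ENNReal.ofReal_add (Real.exp_pos _).le zero_le_one,
            ← ENNReal.ofReal_ofNat 2, ← ENNReal.ofReal_mul zero_le_two]
          refine ENNReal.ofReal_le_ofReal ?_
          rw [show γ * x = γ / 2 * x + γ / 2 * x by ring, Real.exp_add]
          nlinarith [sq_nonneg (Real.exp (γ / 2 * x) - 1)]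
      _ = _ := by rw [lintegral_add_right _ measurable_const]; simp
  by_contra! hc
  have h2 : (2 : ℝ≥0∞) < 2 := calc
    (2 : ℝ≥0∞) = 2 * 1 := (mul_one _).symm
    _ ≤ 2 * expMoment μ (γ / 2) := by gcongr
    _ ≤ expMoment μ γ + 1 := key
    _ < 1 + 1 := ENNReal.add_lt_add_right ENNReal.one_ne_top h
    _ = 2 := one_add_one_eq_two
  exact lt_irrefl _ h2

/-- A Potter-type bound for the shifts of a tail in `L(γ)`. -/
theorem ClassL.exists_tail_sub_le (hL : ClassL γ μ) (hβ : 0 < β) (hβγ : β < γ) (A : ℝ) :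
    ∃ C x₁ : ℝ, 0 ≤ C ∧ ∀ x, x₁ ≤ x → ∀ y, y ≤ A →
      tail μ (x - y) ≤ C * Real.exp (β * y) * tail μ x := by
  -- A unit step to the right multiplies the tail by about e^{-γ} < e^{-β}. Iterating handles
  -- integer steps, and rounding down costs a factor e^β.
  have h1 : ∀ᶠ x in atTop, tail μ (x - -1) / tail μ x < Real.exp (-β) :=
    (hL.tendsto_shift (-1)).eventually (gt_mem_nhds (by rw [Real.exp_lt_exp]; linarith))
  obtain ⟨x₀, hx₀⟩ := eventually_atTop.1 h1
  have hn : ∀ n : ℕ, ∀ x, x₀ ≤ x → tail μ (x + n) ≤ Real.exp (-β * n) * tail μ x := by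
    intro n
    induction n with
    | zero => intro x _; simp
    | succ n ih =>
      intro x hx
      have h2 := ((div_lt_iff₀ (hL.tail_pos (x + n))).1
        (hx₀ (x + n) (le_add_of_le_of_nonneg hx n.cast_nonneg))).le
      have h3 := mul_le_mul_of_nonneg_left (ih x hx) (Real.exp_pos (-β)).le
      rw [show x + n - -1 = x + ((n + 1 : ℕ) : ℝ) by push_cast; ring] at h2
      refine (h2.trans h3).trans_eq ?_
      rw [← mul_assoc, ← Real.exp_add]
      congr 2; push_cast; ring
  have hk : ∀ k, 0 ≤ k → ∀ x, x₀ ≤ x →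
      tail μ (x + k) ≤ Real.exp β * Real.exp (-β * k) * tail μ x := by
    intro k hk x hx
    refine (tail_antitone μ (by linarith [Nat.floor_le hk])).trans ((hn ⌊k⌋₊ x hx).trans ?_)
    refine mul_le_mul_of_nonneg_right ?_ (tail_nonneg _ _)
    rw [← Real.exp_add, Real.exp_le_exp]
    nlinarith [Nat.lt_floor_add_one k]
  obtain ⟨x₂, hx₂⟩ := eventually_atTop.1
    ((hL.tendsto_shift A).eventually (gt_mem_nhds (lt_add_one _)))
  -- The base point is x - A, so that A - y ≥ 0 is a step to the right; the last factor compares the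
  -- tail at x - A with that at x.
  refine ⟨Real.exp β * Real.exp (-β * A) * (Real.exp (γ * A) + 1), max x₂ (x₀ + A), by positivity,
    fun x hx y hy => ?_⟩
  have h4 := hk (A - y) (by linarith) (x - A) (by linarith [le_max_right x₂ (x₀ + A)])
  have h5 := ((div_lt_iff₀ (hL.tail_pos x)).1 (hx₂ x ((le_max_left _ _).trans hx))).le
  rw [show x - A + (A - y) = x - y by ring] at h4
  refine h4.trans ?_
  rw [show -β * (A - y) = -β * A + β * y by ring, Real.exp_add]
  calc _ ≤ Real.exp β * (Real.exp (-β * A) * Real.exp (β * y)) *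
        ((Real.exp (γ * A) + 1) * tail μ x) := by gcongr
    _ = _ := by ring

theorem tail_le_exp_mul (hβ : 0 ≤ β) (h : expMoment ν β < ∞) (x : ℝ) :
    tail ν x ≤ Real.exp (-β * x) * (expMoment ν β).toReal := by
  rw [tail_eq_real, ← integral_exp_eq, ← integral_const_mul,
    ← integral_indicator_one measurableSet_Ioi]
  refine integral_mono ?_ ((integrable_exp_of_expMoment_lt_top h).const_mul _) fun y => ?_
  · exact (integrable_const (1 : ℝ)).indicator measurableSet_Ioi
  · by_cases hy : x < y
    · simp only [Set.indicator_of_mem (Set.mem_Ioi.2 hy), Pi.one_apply]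
      rw [← Real.exp_add, Real.one_le_exp_iff]
      nlinarith
    · simp only [Set.indicator_of_notMem (mt Set.mem_Ioi.1 hy)]
      positivity

/-- One step of the Kesten-type recursion. -/
theorem ClassS.exists_tail_conv_le (hS : ClassS γ μ) (hφ : expMoment μ γ < 1) (hβ : 0 < β)
    (hβγ : β < γ) (hβ1 : expMoment μ β < 1) :
    ∃ A δ C : ℝ, 0 ≤ A ∧ 0 ≤ δ ∧ δ < 1 ∧ 0 ≤ C ∧ ∀ (ν : Measure ℝ) [IsProbabilityMeasure ν],
      expMoment ν β < ∞ → ∀ a, 0 ≤ a → (∀ z, A ≤ z → tail ν z ≤ a * tail μ z) →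
      ∀ x, A ≤ x → tail (μ.conv ν) x ≤ (δ * a + C * (expMoment ν β).toReal) * tail μ x := by
  set φ := (expMoment μ γ).toReal with hφ_def
  have hφ0 : 0 < φ := expMoment_toReal_pos hS.expMoment_lt_top
  have hφ1 : φ < 1 := by
    rw [hφ_def, ← ENNReal.toReal_one]
    exact (ENNReal.toReal_lt_toReal hS.expMoment_lt_top.ne ENNReal.one_ne_top).2 hφ
  have hlim := (tendsto_setIntegral_exp hS.expMoment_lt_top).const_sub (2 * φ)
  rw [← hφ_def, show 2 * φ - φ = φ by ring] at hlim
  -- The integral in `hG` has limiting coefficient 2φ minus the moment truncated at A, which is near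
  -- φ for large A. Hence the contraction factor (1 + φ)/2 < 1.
  obtain ⟨A, hA0, hA⟩ := ((eventually_ge_atTop 0).and
    (hlim.eventually (gt_mem_nhds (show φ < (1 + φ) / 2 by linarith)))).exists
  have hG : ∀ᶠ x in atTop, (∫ y in Set.Iic (x - A), tail μ (x - y) ∂μ) ≤
      (1 + φ) / 2 * tail μ x := by
    filter_upwards [(hS.tendsto_tail_conv.sub (hS.tendsto_setIntegral_self (ρ := μ) A)).eventually
      (gt_mem_nhds hA)] with x hx
    rw [← sub_div, div_lt_iff₀ (hS.tail_pos x)] at hx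
    refine le_trans ?_ hx.le
    rw [le_sub_iff_add_le, ← measureReal_prod_fst_le, ← measureReal_prod_snd_le, tail_conv,
      ← measureReal_union]
    · exact measureReal_mono fun p hp => hp.elim (fun h => h.2) (fun h => h.2)
    · rw [Set.disjoint_left]; rintro p h h'; simp only [Set.mem_ofPred_eq] at h h'; grind
    · measurability
  obtain ⟨C, x₁, hC, hPot⟩ := hS.exists_tail_sub_le hβ hβγ A
  obtain ⟨x₂, hx₂⟩ := eventually_atTop.1 hG
  set x₃ := max x₁ x₂
  have hp := hS.tail_pos x₃
  refine ⟨A, (1 + φ) / 2, C + 1 / tail μ x₃, hA0, by positivity, by linarith, by positivity, ?_⟩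
  intro ν _ hν a ha hdom x hx
  have hm0 : 0 ≤ (expMoment ν β).toReal := ENNReal.toReal_nonneg
  have hT := tail_nonneg μ x
  rcases le_total x₃ x with hx3 | hx3
  -- Split on the `μ`-variable y. If y ≤ x - A, the `ν`-variable exceeds A and the bound with `a`
  -- applies; otherwise y > x - min A z, which the Potter bound controls.
  · have hsplit : tail (μ.conv ν) x = (∫ y in Set.Iic (x - A), tail ν (x - y) ∂μ) +
        ∫ z, tail μ (x - min A z) ∂ν := by
      have : ∫ z, tail μ (x - min A z) ∂ν =
          (μ.prod ν).real {p | x - A < p.1 ∧ x < p.1 + p.2} := by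
        rw [← Measure.prod_swap, map_measureReal_apply measurable_swap (by measurability),
          measureReal_prod_eq_integral _ _ (by measurability)]
        refine integral_congr_ae (.of_forall fun z => ?_)
        simp only [tail_eq_real]
        congr 1; ext y
        simp only [Set.mem_Ioi, Set.mem_preimage, Prod.swap_prod_mk, Set.mem_ofPred_eq]
        grind
      rw [this, ← measureReal_prod_fst_le, tail_conv, ← measureReal_union]
      · congr 1; ext p; simp only [Set.mem_ofPred_eq, Set.mem_union]; grind
      · rw [Set.disjoint_left]; rintro p h h'; simp only [Set.mem_ofPred_eq] at h h'; grind
      · measurability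
    have h1 : (∫ y in Set.Iic (x - A), tail ν (x - y) ∂μ) ≤ a * ((1 + φ) / 2 * tail μ x) := by
      refine le_trans ?_ (mul_le_mul_of_nonneg_left (hx₂ x ((le_max_right _ _).trans hx3)) ha)
      rw [← integral_const_mul]
      have hm : Measurable fun y => x - y := by fun_prop
      refine setIntegral_mono_on (integrable_tail_comp ν _ hm).integrableOn
        ((integrable_tail_comp μ _ hm).const_mul a).integrableOn measurableSet_Iic fun y hy => ?_
      exact hdom _ (by linarith [Set.mem_Iic.1 hy])
    have h2 : ∫ z, tail μ (x - min A z) ∂ν ≤ C * tail μ x * (expMoment ν β).toReal := by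
      rw [← integral_exp_eq, ← integral_const_mul]
      refine integral_mono (integrable_tail_comp μ _ (by fun_prop))
        ((integrable_exp_of_expMoment_lt_top hν).const_mul _) fun z => ?_
      refine (hPot x ((le_max_left _ _).trans hx3) (min A z) (min_le_left _ _)).trans ?_
      have : Real.exp (β * min A z) ≤ Real.exp (β * z) :=
        Real.exp_le_exp.2 (mul_le_mul_of_nonneg_left (min_le_right _ _) hβ.le)
      calc _ ≤ C * Real.exp (β * z) * tail μ x := by gcongr
        _ = _ := by ring
    have h3 : 0 ≤ 1 / tail μ x₃ * (expMoment ν β).toReal * tail μ x := by positivity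
    rw [hsplit]
    nlinarith
  -- On the bounded range A ≤ x ≤ x₃ a Chernoff bound suffices; the term `1 / tail μ x₃` in the
  -- constant pays for it.
  · have hm : expMoment (μ.conv ν) β < ∞ := by
      rw [expMoment_conv]; exact ENNReal.mul_lt_top (hβ1.trans ENNReal.one_lt_top) hν
    have h1 := tail_le_exp_mul hβ.le hm x
    have h2 : Real.exp (-β * x) ≤ 1 := Real.exp_le_one_iff.2 (by nlinarith)
    have h3 : (expMoment (μ.conv ν) β).toReal ≤ (expMoment ν β).toReal := by
      refine ENNReal.toReal_mono hν.ne ?_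
      rw [expMoment_conv]
      exact mul_le_of_le_one_left' hβ1.le
    have h4 : tail (μ.conv ν) x ≤ (expMoment ν β).toReal := by
      refine h1.trans ((mul_le_mul h2 h3 ENNReal.toReal_nonneg zero_le_one).trans_eq (one_mul _))
    have h5 : 1 ≤ 1 / tail μ x₃ * tail μ x := by
      rw [one_div_mul_eq_div, le_div_iff₀ hp, one_mul]; exact tail_antitone μ hx3
    have h6 : (expMoment ν β).toReal ≤ (expMoment ν β).toReal * (1 / tail μ x₃ * tail μ x) :=
      le_mul_of_one_le_right hm0 h5
    have h7 : 0 ≤ ((1 + φ) / 2 * a + C * (expMoment ν β).toReal) * tail μ x := by positivity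
    nlinarith

/-- The law of `S_n`. -/
noncomputable def walkLaw (μ : Measure ℝ) : ℕ → Measure ℝ
  | 0 => Measure.dirac 0
  | n + 1 => μ.conv (walkLaw μ n)

instance (n : ℕ) : IsProbabilityMeasure (walkLaw μ n) := by
  induction n with
  | zero => unfold walkLaw; infer_instance
  | succ n ih => unfold walkLaw; infer_instance

theorem expMoment_walkLaw (μ : Measure ℝ) [IsProbabilityMeasure μ] (α : ℝ) (n : ℕ) :
    expMoment (walkLaw μ n) α = expMoment μ α ^ n := by
  induction n with
  | zero => simp [walkLaw, expMoment]
  | succ n ih => rw [walkLaw, expMoment_conv, ih, pow_succ']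

/-- Summing the recursion bounds (1 - δ) times each partial sum by a₀ + Σ b. -/
theorem summable_of_affine_recursion {δ : ℝ} {a b : ℕ → ℝ} (hδ1 : δ < 1) (ha : ∀ n, 0 ≤ a n)
    (hb0 : ∀ n, 0 ≤ b n) (hb : Summable b) (h : ∀ n, a (n + 1) = δ * a n + b n) :
    Summable a := by
  refine summable_of_sum_range_le (c := (a 0 + ∑' n, b n) / (1 - δ)) ha fun n => ?_
  rw [le_div_iff₀ (by linarith)]
  have h1 : ∑ i ∈ Finset.range n, a i + a n =
      a 0 + δ * ∑ i ∈ Finset.range n, a i + ∑ i ∈ Finset.range n, b i := by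
    rw [← Finset.sum_range_succ, Finset.sum_range_succ', Finset.mul_sum]
    simp_rw [h]
    rw [Finset.sum_add_distrib]; ring
  have h2 := hb.sum_le_tsum (Finset.range n) fun i _ => hb0 i
  linarith [ha n]

/-- Summable domination of the tails of the partial sums. -/
theorem ClassS.exists_summable_tail_walkLaw_le (hS : ClassS γ μ) (hγ : 0 < γ)
    (hφ : expMoment μ γ < 1) :
    ∃ (A : ℝ) (a : ℕ → ℝ), 0 ≤ A ∧ (∀ n, 0 ≤ a n) ∧ Summable a ∧
      ∀ n x, A ≤ x → tail (walkLaw μ n) x ≤ a n * tail μ x := by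
  have hβ1 := expMoment_half_lt_one hφ
  obtain ⟨A, δ, C, hA, hδ, hδ1, hC, hstep⟩ := hS.exists_tail_conv_le hφ (half_pos hγ)
    (half_lt_self hγ) hβ1
  set r := (expMoment μ (γ / 2)).toReal with hr
  have hr0 : 0 ≤ r := ENNReal.toReal_nonneg
  have hr1 : r < 1 := by
    rw [hr, ← ENNReal.toReal_one]
    exact (ENNReal.toReal_lt_toReal (hβ1.trans ENNReal.one_lt_top).ne ENNReal.one_ne_top).2 hβ1
  -- The recursion may start at 0 because S_0 = 0 has no mass above A ≥ 0. The forcing term is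
  -- geometric since the γ/2-moment of S_n is rⁿ.
  let a : ℕ → ℝ := fun n => Nat.rec 0 (fun n an => δ * an + C * r ^ n) n
  have ha0 : ∀ n, 0 ≤ a n := by
    intro n
    induction n with
    | zero => exact le_rfl
    | succ n ih => exact add_nonneg (mul_nonneg hδ ih) (by positivity)
  refine ⟨A, a, hA, ha0, summable_of_affine_recursion hδ1 ha0 (b := fun n => C * r ^ n)
    (fun n => by positivity) ((summable_geometric_of_lt_one hr0 hr1).mul_left C) fun _ => rfl, ?_⟩
  intro n
  induction n with
  | zero =>
    intro x hx
    rw [tail_eq_real, walkLaw, measureReal_def, Measure.dirac_apply' _ measurableSet_Ioi]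
    simp [hA.trans hx, a]
  | succ n ih =>
    intro x hx
    have hfin : expMoment (walkLaw μ n) (γ / 2) < ∞ := by
      rw [expMoment_walkLaw]; exact ENNReal.pow_lt_top (hβ1.trans ENNReal.one_lt_top)
    have := hstep (walkLaw μ n) hfin (a n) (ha0 n) ih x hx
    rwa [expMoment_walkLaw, ENNReal.toReal_pow] at this

end Kesten


/-! ### Path properties, independence and laws of S_n and M_N. -/

section Walk

variable {Ω : Type*}

/-- The running maximum `M_N` as a real number, computed by the recursion
`M_{N+1} = max 0 (ξ 0 + M_N')` with `M_N'` the maximum of the walk of the shifted increments. -/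
noncomputable def runningMax : ℕ → (ℕ → Ω → ℝ) → Ω → ℝ
  | 0, _ => fun _ => 0
  | N + 1, ξ => fun ω => max 0 (ξ 0 ω + runningMax N (fun i => ξ (i + 1)) ω)

theorem walk_zero (ξ : ℕ → Ω → ℝ) (ω : Ω) : walk ξ 0 ω = 0 := by simp [walk]

theorem walk_succ (ξ : ℕ → Ω → ℝ) (n : ℕ) (ω : Ω) :
    walk ξ (n + 1) ω = ξ 0 ω + walk (fun i => ξ (i + 1)) n ω := by
  rw [walk, Finset.sum_range_succ', add_comm]; rfl

theorem walk_add (ξ : ℕ → Ω → ℝ) (n k : ℕ) (ω : Ω) :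
    walk ξ (n + k) ω = walk ξ n ω + walk (fun i => ξ (i + n)) k ω := by
  rw [walk, Finset.sum_range_add]
  simp only [walk, add_comm]

theorem walk_le_runningMax (N : ℕ) (ξ : ℕ → Ω → ℝ) (ω : Ω) :
    ∀ n ≤ N, walk ξ n ω ≤ runningMax N ξ ω := by
  induction N generalizing ξ with
  | zero => intro n hn; rw [Nat.le_zero.1 hn, walk_zero]; exact le_rfl
  | succ N ih =>
    intro n hn
    rw [runningMax]
    cases n with
    | zero => rw [walk_zero]; exact le_max_left _ _
    | succ n =>
      rw [walk_succ]
      exact le_max_of_le_right (add_le_add_right (ih _ n (Nat.le_of_succ_le_succ hn)) _)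

theorem exists_walk_eq_runningMax (N : ℕ) (ξ : ℕ → Ω → ℝ) (ω : Ω) :
    ∃ n ≤ N, walk ξ n ω = runningMax N ξ ω := by
  induction N generalizing ξ with
  | zero => exact ⟨0, le_rfl, walk_zero ξ ω⟩
  | succ N ih =>
    simp only [runningMax]
    rcases max_choice 0 (ξ 0 ω + runningMax N (fun i => ξ (i + 1)) ω) with h | h
    · exact ⟨0, Nat.zero_le _, by rw [h, walk_zero]⟩
    · obtain ⟨n, hn, hw⟩ := ih fun i => ξ (i + 1)
      exact ⟨n + 1, Nat.succ_le_succ hn, by rw [h, walk_succ, hw]⟩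

theorem walkMax_coe (N : ℕ) (ξ : ℕ → Ω → ℝ) (ω : Ω) :
    walkMax ξ N ω = (runningMax N ξ ω : EReal) := by
  refine le_antisymm (iSup₂_le fun n hn => ?_) ?_
  · exact EReal.coe_le_coe_iff.2 (walk_le_runningMax N ξ ω n (Nat.cast_le.1 hn))
  · obtain ⟨n, hn, hw⟩ := exists_walk_eq_runningMax N ξ ω
    rw [← hw]
    exact le_iSup₂ (f := fun (n : ℕ) (_ : (n : ℕ∞) ≤ N) => (walk ξ n ω : EReal)) n
      (Nat.cast_le.2 hn)

theorem mem_exceedEvent {ξ : ℕ → Ω → ℝ} {N : ℕ∞} {x : ℝ} {ω : Ω} :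
    ω ∈ exceedEvent ξ N x ↔ ∃ n : ℕ, (n : ℕ∞) ≤ N ∧ x < walk ξ n ω := by
  simp [exceedEvent, walkMax, lt_iSup_iff, EReal.coe_lt_coe_iff]

theorem exceedEvent_mono (ξ : ℕ → Ω → ℝ) (x : ℝ) : Monotone fun N => exceedEvent ξ N x := by
  intro N N' h ω hω
  obtain ⟨n, hn, hx⟩ := mem_exceedEvent.1 hω
  exact mem_exceedEvent.2 ⟨n, hn.trans h, hx⟩

theorem mem_jumpEvent {ξ : ℕ → Ω → ℝ} {n : ℕ} {a x : ℝ} {ω : Ω} :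
    ω ∈ jumpEvent ξ n a x ↔ (∀ k ≤ n - 1, walk ξ k ω ≤ a) ∧ x < walk ξ n ω := by
  simp only [jumpEvent, walkMax, iSup_le_iff, EReal.coe_le_coe_iff, Nat.cast_le,
    Set.mem_ofPred_eq]

theorem measurable_walk [MeasurableSpace Ω] {ξ : ℕ → Ω → ℝ} (h : ∀ i, Measurable (ξ i)) (n : ℕ) :
    Measurable (walk ξ n) :=
  Finset.measurable_fun_sum _ fun i _ => h i

theorem measurable_runningMax [MeasurableSpace Ω] (N : ℕ) {ξ : ℕ → Ω → ℝ}
    (h : ∀ i, Measurable (ξ i)) : Measurable (runningMax N ξ) := by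
  induction N generalizing ξ with
  | zero => exact measurable_const
  | succ N ih => exact measurable_const.max ((h 0).add (ih fun i => h (i + 1)))

theorem measurable_walkMax [MeasurableSpace Ω] {ξ : ℕ → Ω → ℝ} (h : ∀ i, Measurable (ξ i))
    (N : ℕ∞) : Measurable (walkMax ξ N) :=
  .iSup fun n => .iSup fun _ => (measurable_walk h n).coe_real_ereal

theorem measurableSet_exceedEvent [MeasurableSpace Ω] {ξ : ℕ → Ω → ℝ}
    (h : ∀ i, Measurable (ξ i)) (N : ℕ∞) (x : ℝ) : MeasurableSet (exceedEvent ξ N x) :=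
  measurableSet_lt measurable_const (measurable_walkMax h N)

/-- The variables `ξ i` are independent with common law `μ`. -/
structure IsIID [MeasurableSpace Ω] (P : Measure Ω) (μ : Measure ℝ) (ξ : ℕ → Ω → ℝ) : Prop where
  measurable : ∀ i, Measurable (ξ i)
  indep : iIndepFun ξ P
  law : ∀ i, P.map (ξ i) = μ

/-- The law of `M_N`. -/
noncomputable def maxLaw (μ : Measure ℝ) : ℕ → Measure ℝ
  | 0 => Measure.dirac 0
  | N + 1 => (μ.conv (maxLaw μ N)).map (max 0)

instance (μ : Measure ℝ) [IsProbabilityMeasure μ] (n : ℕ) : IsProbabilityMeasure (maxLaw μ n) := by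
  induction n with
  | zero => unfold maxLaw; infer_instance
  | succ n ih => unfold maxLaw; exact Measure.isProbabilityMeasure_map (by fun_prop)

theorem measurable_iSup_comap (ξ : ℕ → Ω → ℝ) {S : Set ℕ} {i : ℕ} (hi : i ∈ S) :
    Measurable[⨆ i ∈ S, (inferInstance : MeasurableSpace ℝ).comap (ξ i)] (ξ i) :=
  (comap_measurable (ξ i)).mono
    (le_iSup₂ (f := fun i (_ : i ∈ S) => (inferInstance : MeasurableSpace ℝ).comap (ξ i)) i hi)
    le_rfl

theorem walkMax_mono (ξ : ℕ → Ω → ℝ) (ω : Ω) : Monotone fun N => walkMax ξ N ω :=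
  fun _ _ h => iSup_mono fun n => iSup_le fun hn => le_iSup (fun _ => (walk ξ n ω : EReal))
      (hn.trans h)

theorem tendsto_walkMax (ξ : ℕ → Ω → ℝ) (ω : Ω) :
    Tendsto (fun N : ℕ => walkMax ξ N ω) atTop (𝓝 (walkMax ξ ⊤ ω)) := by
  have hmono : Monotone fun N : ℕ => walkMax ξ N ω :=
    fun N N' h => walkMax_mono ξ ω (Nat.cast_le.2 h)
  convert tendsto_atTop_iSup hmono
  refine le_antisymm (iSup₂_le fun n _ => ?_) (iSup_le fun N => ?_)
  · refine le_trans ?_ (le_iSup _ n)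
    exact le_iSup₂ (f := fun (k : ℕ) (_ : (k : ℕ∞) ≤ n) => (walk ξ k ω : EReal)) n le_rfl
  · exact walkMax_mono ξ ω le_top

variable [MeasurableSpace Ω] {P : Measure Ω} [IsProbabilityMeasure P] {μ : Measure ℝ}
  [IsProbabilityMeasure μ] {ξ : ℕ → Ω → ℝ}

omit [IsProbabilityMeasure P] [IsProbabilityMeasure μ] in
theorem IsIID.shift (h : IsIID P μ ξ) (n : ℕ) : IsIID P μ fun i => ξ (i + n) :=
  ⟨fun _ => h.measurable _, h.indep.precomp (add_left_injective n), fun _ => h.law _⟩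

omit [IsProbabilityMeasure P] [IsProbabilityMeasure μ] in
theorem IsIID.indepFun (h : IsIID P μ ξ) (n : ℕ) {X Y : Ω → ℝ}
    (hX : Measurable[⨆ i ∈ Set.Iio n, (inferInstance : MeasurableSpace ℝ).comap (ξ i)] X)
    (hY : Measurable[⨆ i ∈ Set.Ici n, (inferInstance : MeasurableSpace ℝ).comap (ξ i)] Y) :
    IndepFun X Y P := by
  rw [IndepFun_iff_Indep]
  refine indep_of_indep_of_le_left (indep_of_indep_of_le_right
    (indep_iSup_of_disjoint (fun i => (h.measurable i).comap_le)
      ((iIndepFun_iff_iIndep _ _ _).1 h.indep) (S := Set.Iio n) (T := Set.Ici n) ?_)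
      hY.comap_le) hX.comap_le
  exact Set.disjoint_left.2 fun _ hi hi' => absurd (Set.mem_Iio.1 hi) (not_lt.2 hi')

omit [IsProbabilityMeasure P] [IsProbabilityMeasure μ] in
theorem IsIID.indepFun_walk_walk (h : IsIID P μ ξ) (n k : ℕ) :
    IndepFun (walk ξ n) (walk (fun i => ξ (i + n)) k) P := by
  refine h.indepFun n ?_ ?_
  · exact Finset.measurable_fun_sum _ fun i hi =>
      measurable_iSup_comap ξ (Set.mem_Iio.2 (Finset.mem_range.1 hi))
  · exact @measurable_walk _ (⨆ i ∈ Set.Ici n, (inferInstance : MeasurableSpace ℝ).comap (ξ i)) _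
      (fun i => measurable_iSup_comap ξ (Set.mem_Ici.2 (Nat.le_add_left n i))) k

omit [IsProbabilityMeasure P] [IsProbabilityMeasure μ] in
theorem IsIID.indepFun_runningMax (h : IsIID P μ ξ) (N : ℕ) :
    IndepFun (ξ 0) (runningMax N fun i => ξ (i + 1)) P := by
  refine h.indepFun 1 (measurable_iSup_comap ξ (Set.mem_Iio.2 one_pos)) ?_
  exact @measurable_runningMax _ (⨆ i ∈ Set.Ici 1, (inferInstance : MeasurableSpace ℝ).comap (ξ i))
    N _ (fun i => measurable_iSup_comap ξ (Set.mem_Ici.2 (Nat.le_add_left 1 i)))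

omit [IsProbabilityMeasure μ] in
theorem IsIID.map_walk (h : IsIID P μ ξ) (n : ℕ) : P.map (walk ξ n) = walkLaw μ n := by
  induction n generalizing ξ with
  | zero =>
    have : walk ξ 0 = fun _ => 0 := funext (walk_zero ξ)
    rw [this, walkLaw, Measure.map_const, measure_univ, one_smul]
  | succ n ih =>
    have h1 : walk ξ (n + 1) = walk ξ 1 + walk (fun i => ξ (i + 1)) n := by
      ext ω; rw [add_comm n, walk_add]; rfl
    have h2 : walk ξ 1 = ξ 0 := by ext ω; simp [walk]
    rw [h1, (h.indepFun_walk_walk 1 n).map_add_eq_map_conv_map (measurable_walk h.measurable 1)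
      (measurable_walk (h.shift 1).measurable n), ih (h.shift 1), h2, h.law, walkLaw]

omit [IsProbabilityMeasure μ] in
theorem IsIID.map_runningMax (h : IsIID P μ ξ) (N : ℕ) :
    P.map (runningMax N ξ) = maxLaw μ N := by
  induction N generalizing ξ with
  | zero =>
    change P.map (fun _ => 0) = _
    rw [maxLaw, Measure.map_const, measure_univ, one_smul]
  | succ N ih =>
    have h1 : runningMax (N + 1) ξ = max 0 ∘ (ξ 0 + runningMax N fun i => ξ (i + 1)) := rfl
    have hm := measurable_runningMax N (h.shift 1).measurable
    rw [h1, ← Measure.map_map (by fun_prop) ((h.measurable 0).add hm),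
      (h.indepFun_runningMax N).map_add_eq_map_conv_map (h.measurable 0) hm, ih (h.shift 1),
      h.law, maxLaw]

theorem IsIID.measureReal_exceedEvent (h : IsIID P μ ξ) (N : ℕ) (x : ℝ) :
    P.real (exceedEvent ξ N x) = tail (maxLaw μ N) x := by
  rw [tail_eq_real, ← h.map_runningMax N,
    map_measureReal_apply (measurable_runningMax N h.measurable) measurableSet_Ioi]
  congr 1
  ext ω
  simp [exceedEvent, walkMax_coe, EReal.coe_lt_coe_iff]

theorem IsIID.measureReal_lt_walk (h : IsIID P μ ξ) (n : ℕ) (x : ℝ) :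
    P.real {ω | x < walk ξ n ω} = tail (walkLaw μ n) x := by
  rw [tail_eq_real, ← h.map_walk n,
    map_measureReal_apply (measurable_walk h.measurable n) measurableSet_Ioi]
  rfl

omit [IsProbabilityMeasure μ] in
theorem IsIID.measureReal_two_jumps (h : IsIID P μ ξ) (n k : ℕ) (K x : ℝ) :
    P.real {ω | K < walk ξ n ω ∧ K < walk (fun i => ξ (i + n)) k ω ∧ x < walk ξ (n + k) ω} =
      jointTail (walkLaw μ n) (walkLaw μ k) K x := by
  have hm := measurable_walk h.measurable n
  have hm' := measurable_walk (h.shift n).measurable k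
  rw [jointTail, ← h.map_walk n, ← (h.shift n).map_walk k,
    ← (h.indepFun_walk_walk n k).map_prod_eq_prod_map_map hm.aemeasurable hm'.aemeasurable,
    map_measureReal_apply (hm.prodMk hm') (by measurability)]
  congr 1
  ext ω
  simp [walk_add]

omit [IsProbabilityMeasure μ] in
theorem IsIID.maxExpMoment_coe (h : IsIID P μ ξ) (γ : ℝ) (N : ℕ) :
    maxExpMoment P ξ γ N = expMoment (maxLaw μ N) γ := by
  rw [maxExpMoment, expMoment, ← h.map_runningMax N,
    lintegral_map (by fun_prop) (measurable_runningMax N h.measurable)]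
  refine lintegral_congr fun ω => ?_
  rw [walkMax_coe, ← EReal.coe_mul, EReal.exp_coe]

theorem maxExpMoment_mono (P : Measure Ω) (ξ : ℕ → Ω → ℝ) {γ : ℝ} (hγ : 0 < γ) :
    Monotone (maxExpMoment P ξ γ) := fun _ _ h => lintegral_mono fun ω =>
  EReal.exp_monotone (mul_le_mul_of_nonneg_left (walkMax_mono ξ ω h) (EReal.coe_nonneg.2 hγ.le))

omit [IsProbabilityMeasure P] [IsProbabilityMeasure μ] in
theorem IsIID.tendsto_maxExpMoment (h : IsIID P μ ξ) {γ : ℝ} (hγ : 0 < γ) :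
    Tendsto (fun N : ℕ => maxExpMoment P ξ γ N) atTop (𝓝 (maxExpMoment P ξ γ ⊤)) := by
  refine lintegral_tendsto_of_tendsto_of_monotone (fun N => ?_) (.of_forall fun ω => ?_)
    (.of_forall fun ω => ?_)
  · exact (EReal.measurable_exp.comp
      ((measurable_walkMax h.measurable N).const_mul _)).aemeasurable
  · exact fun N N' hN => EReal.exp_monotone (mul_le_mul_of_nonneg_left
      (walkMax_mono ξ ω (Nat.cast_le.2 hN)) (EReal.coe_nonneg.2 hγ.le))
  · refine (ENNReal.continuous_exp.tendsto _).comp ?_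
    -- The supremum may be infinite, and multiplication on `EReal` is continuous there only because
    -- the other factor is nonzero.
    have hγ0 : (γ : EReal) ≠ 0 := EReal.coe_ne_zero.2 hγ.ne'
    have := (EReal.continuousAt_mul (p := ((γ : EReal), walkMax ξ ⊤ ω)) (.inl hγ0) (.inl hγ0)
      (.inl (EReal.coe_ne_bot γ)) (.inl (EReal.coe_ne_top γ))).tendsto
    exact this.comp (tendsto_const_nhds.prodMk_nhds (tendsto_walkMax ξ ω))

end Walk


/-! ### The constants c_N and the asymptotics of P(M_N > x) at fixed N. -/

section Limit

variable {Ω : Type*} [MeasurableSpace Ω] {P : Measure Ω} [IsProbabilityMeasure P] {μ : Measure ℝ}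
  [IsProbabilityMeasure μ] {ξ : ℕ → Ω → ℝ} {γ : ℝ}

omit [IsProbabilityMeasure P] [IsProbabilityMeasure μ] in
theorem limitConst_succ (N : ℕ) :
    limitConst P ξ μ γ ((N + 1 : ℕ) : ℕ∞) =
      maxExpMoment P ξ γ N + expMoment μ γ * limitConst P ξ μ γ N := by
  rw [limitConst_coe, limitConst_coe, ← Finset.Ico_add_one_right_eq_Icc,
    ← Finset.Ico_add_one_right_eq_Icc, Finset.sum_Ico_eq_sum_range, Finset.sum_Ico_eq_sum_range,
    Nat.add_sub_cancel, Nat.add_sub_cancel, Finset.sum_range_succ', add_comm, Finset.mul_sum]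
  congr 1
  · simp
  · refine Finset.sum_congr rfl fun n _ => ?_
    rw [← mul_assoc, ← pow_succ']
    congr 3 <;> omega

/-- From e^{γ max(0,y)} ≤ e^{γy} + 1 the moments satisfy m_{N+1} ≤ φ m_N + 1. The geometric series
then bounds E e^{γM}. -/
theorem expMoment_maxLaw_le (μ : Measure ℝ) [IsProbabilityMeasure μ] (γ : ℝ) (N : ℕ) :
    expMoment (maxLaw μ N) γ ≤ ∑ n ∈ Finset.range (N + 1), expMoment μ γ ^ n := by
  induction N with
  | zero => simp [maxLaw, expMoment]
  | succ N ih =>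
    calc expMoment (maxLaw μ (N + 1)) γ
        = ∫⁻ y, ENNReal.ofReal (Real.exp (γ * max 0 y)) ∂(μ.conv (maxLaw μ N)) := by
          rw [maxLaw, expMoment, lintegral_map (by fun_prop) (by fun_prop)]
      _ ≤ ∫⁻ y, (ENNReal.ofReal (Real.exp (γ * y)) + 1) ∂(μ.conv (maxLaw μ N)) := by
          refine lintegral_mono fun y => ?_
          rcases max_choice 0 y with h | h <;> rw [h] <;> simp
      _ = expMoment μ γ * expMoment (maxLaw μ N) γ + 1 := by
          rw [lintegral_add_right _ measurable_const, ← expMoment_conv]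
          simp [expMoment]
      _ ≤ expMoment μ γ * (∑ n ∈ Finset.range (N + 1), expMoment μ γ ^ n) + 1 := by gcongr
      _ = _ := by
          rw [Finset.sum_range_succ' _ (N + 1), Finset.mul_sum, pow_zero]
          simp_rw [pow_succ']

theorem IsIID.maxExpMoment_top_lt_top (h : IsIID P μ ξ) (hγ : 0 < γ) (hφ : expMoment μ γ < 1) :
    maxExpMoment P ξ γ ⊤ < ∞ := by
  refine (le_of_tendsto' (h.tendsto_maxExpMoment hγ) fun N => ?_ :
    maxExpMoment P ξ γ ⊤ ≤ (1 - expMoment μ γ)⁻¹).trans_lt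
      (ENNReal.inv_lt_top.2 (tsub_pos_of_lt hφ))
  rw [h.maxExpMoment_coe, ← ENNReal.tsum_geometric]
  exact (expMoment_maxLaw_le μ γ N).trans (ENNReal.sum_le_tsum _)

theorem IsIID.limitConst_top_lt_top (h : IsIID P μ ξ) (hγ : 0 < γ) (hφ : expMoment μ γ < 1) :
    limitConst P ξ μ γ ⊤ < ∞ := by
  rw [limitConst_top]
  exact ENNReal.div_lt_top (h.maxExpMoment_top_lt_top hγ hφ).ne (tsub_pos_of_lt hφ).ne'

omit [IsProbabilityMeasure P] [IsProbabilityMeasure μ] in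
theorem limitConst_mono (hγ : 0 < γ) : Monotone (limitConst P ξ μ γ) := by
  intro N N' h
  refine (ENNReal.tsum_le_tsum fun n => ?_).trans (ENNReal.tsum_comp_le_tsum_of_injective
    (f := fun n : {n : ℕ // 1 ≤ n ∧ (n : ℕ∞) ≤ N} =>
      (⟨n, n.2.1, n.2.2.trans h⟩ : {n : ℕ // 1 ≤ n ∧ (n : ℕ∞) ≤ N'}))
    (fun a b hab => Subtype.ext (congrArg Subtype.val hab :)) _)
  exact mul_le_mul_right (maxExpMoment_mono P ξ hγ (tsub_le_tsub_right h _)) _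

theorem IsIID.limitConst_lt_top (h : IsIID P μ ξ) (hγ : 0 < γ) (hφ : expMoment μ γ < 1)
    (N : ℕ∞) : limitConst P ξ μ γ N < ∞ :=
  (limitConst_mono hγ le_top).trans_lt (h.limitConst_top_lt_top hγ hφ)

theorem IsIID.toReal_limitConst_mono (h : IsIID P μ ξ) (hγ : 0 < γ) (hφ : expMoment μ γ < 1) :
    Monotone fun N => (limitConst P ξ μ γ N).toReal :=
  fun _ N' hN => ENNReal.toReal_mono (h.limitConst_lt_top hγ hφ N').ne (limitConst_mono hγ hN)

theorem IsIID.tendsto_limitConst (h : IsIID P μ ξ) (hγ : 0 < γ) (hφ : expMoment μ γ < 1) :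
    Tendsto (fun N : ℕ => (limitConst P ξ μ γ N).toReal) atTop
      (𝓝 (limitConst P ξ μ γ ⊤).toReal) := by
  have hmono : Monotone fun N : ℕ => limitConst P ξ μ γ N :=
    fun N N' hN => limitConst_mono hγ (Nat.cast_le.2 hN)
  have hlim := tendsto_atTop_iSup hmono
  set L := ⨆ N : ℕ, limitConst P ξ μ γ N with hL
  have hLtop : L ≠ ∞ :=
    ((iSup_le fun N => limitConst_mono hγ le_top).trans_lt (h.limitConst_top_lt_top hγ hφ)).ne
  -- Passing to the limit in `limitConst_succ` gives a linear equation whose only finite solution is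
  -- E e^{γM}/(1 - φ).
  have hrec : L = maxExpMoment P ξ γ ⊤ + expMoment μ γ * L := by
    refine tendsto_nhds_unique ((tendsto_add_atTop_iff_nat 1).2 hlim) ?_
    simp_rw [limitConst_succ]
    exact (h.tendsto_maxExpMoment hγ).add
      (ENNReal.Tendsto.const_mul hlim (.inr (hφ.trans ENNReal.one_lt_top).ne))
  have hLeq : L = limitConst P ξ μ γ ⊤ := by
    rw [limitConst_top, ENNReal.eq_div_iff (tsub_pos_of_lt hφ).ne' (by simp),
      ENNReal.sub_mul fun _ _ => hLtop, one_mul]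
    refine ENNReal.sub_eq_of_eq_add (ENNReal.mul_ne_top (hφ.trans ENNReal.one_lt_top).ne hLtop) ?_
    exact hrec
  rw [← hLeq]
  exact (ENNReal.tendsto_toReal hLtop).comp hlim

theorem tail_map_max_zero (ν : Measure ℝ) [IsProbabilityMeasure ν] {x : ℝ} (hx : 0 ≤ x) :
    tail (ν.map (max 0)) x = tail ν x := by
  have : IsProbabilityMeasure (ν.map (max 0)) := Measure.isProbabilityMeasure_map (by fun_prop)
  rw [tail_eq_real, tail_eq_real, map_measureReal_apply (by fun_prop) measurableSet_Ioi]
  congr 1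
  ext y
  simp [hx]

/-- The asymptotics of `P (M_N > x)` for a fixed finite horizon. -/
theorem IsIID.tendsto_tail_maxLaw (h : IsIID P μ ξ) (hS : ClassS γ μ) (hγ : 0 < γ)
    (hφ : expMoment μ γ < 1) (N : ℕ) :
    Tendsto (fun x => tail (maxLaw μ N) x / tail μ x) atTop
      (𝓝 (limitConst P ξ μ γ N).toReal) := by
  induction N with
  | zero =>
    rw [limitConst_coe]
    refine tendsto_const_nhds.congr' ?_
    filter_upwards [eventually_ge_atTop 0] with x hx
    rw [tail_eq_real, maxLaw, measureReal_def, Measure.dirac_apply' _ measurableSet_Ioi]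
    simp [hx]
  | succ N ih =>
    have hm : maxExpMoment P ξ γ N < ∞ :=
      (maxExpMoment_mono P ξ hγ le_top).trans_lt (h.maxExpMoment_top_lt_top hγ hφ)
    rw [limitConst_succ, ENNReal.toReal_add hm.ne (ENNReal.mul_ne_top
      hS.expMoment_lt_top.ne (h.limitConst_lt_top hγ hφ N).ne), ENNReal.toReal_mul,
      add_comm (ENNReal.toReal _), mul_comm (ENNReal.toReal _)]
    rw [h.maxExpMoment_coe] at hm ⊢
    refine (hS.tendsto_tail_conv_of_tendsto ih hm).congr' ?_
    filter_upwards [eventually_ge_atTop 0] with x hx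
    rw [maxLaw, tail_map_max_zero _ hx]

theorem IsIID.measureReal_exists_lt_walk_le (h : IsIID P μ ξ) {A : ℝ} {a : ℕ → ℝ}
    (ha0 : ∀ n, 0 ≤ a n) (ha : Summable a)
    (hdom : ∀ n x, A ≤ x → tail (walkLaw μ n) x ≤ a n * tail μ x) {x : ℝ} (hx : A ≤ x) (n₀ : ℕ) :
    P.real {ω | ∃ n, n₀ < n ∧ x < walk ξ n ω} ≤ (∑' n, a (n + (n₀ + 1))) * tail μ x := by
  have hs : Summable fun n => a (n + (n₀ + 1)) := (summable_nat_add_iff _).2 ha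
  have hsub : {ω | ∃ n, n₀ < n ∧ x < walk ξ n ω} ⊆ ⋃ n, {ω | x < walk ξ (n + (n₀ + 1)) ω} := by
    rintro ω ⟨n, hn, hω⟩
    refine Set.mem_iUnion.2 ⟨n - (n₀ + 1), ?_⟩
    rwa [Set.mem_ofPred_eq, Nat.sub_add_cancel hn]
  have hnn : 0 ≤ ∑' n, a (n + (n₀ + 1)) * tail μ x :=
    tsum_nonneg fun n => mul_nonneg (ha0 _) (tail_nonneg _ _)
  rw [← tsum_mul_right]
  refine ENNReal.toReal_le_of_le_ofReal hnn ?_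
  rw [ENNReal.ofReal_tsum_of_nonneg (fun n => mul_nonneg (ha0 _) (tail_nonneg _ _))
    (hs.mul_right _)]
  refine (measure_mono hsub).trans ((measure_iUnion_le _).trans (ENNReal.tsum_le_tsum fun n => ?_))
  rw [← ofReal_measureReal, h.measureReal_lt_walk]
  exact ENNReal.ofReal_le_ofReal (hdom _ x hx)

/-! ### Uniformity in N and the single-jump description. -/

/-- The event that two of the increments of the walk over consecutive blocks of length at most `n₀`
exceed `K` while the walk exceeds `x` at the end of the second block. -/
def twoJumpEvent (ξ : ℕ → Ω → ℝ) (n₀ : ℕ) (K x : ℝ) : Set Ω :=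
  ⋃ n ∈ Finset.range (n₀ + 1), ⋃ k ∈ Finset.range (n₀ + 1),
    {ω | K < walk ξ n ω ∧ K < walk (fun i => ξ (i + n)) k ω ∧ x < walk ξ (n + k) ω}

theorem IsIID.measureReal_twoJumpEvent_le (h : IsIID P μ ξ) {A : ℝ} {a : ℕ → ℝ}
    (ha0 : ∀ n, 0 ≤ a n) (hdom : ∀ n x, A ≤ x → tail (walkLaw μ n) x ≤ a n * tail μ x)
    {K : ℝ} (hK : A ≤ K) (x : ℝ) (n₀ : ℕ) :
    P.real (twoJumpEvent ξ n₀ K x) ≤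
      (∑ n ∈ Finset.range (n₀ + 1), ∑ k ∈ Finset.range (n₀ + 1), a n * a k) *
        jointTail μ μ K x := by
  rw [Finset.sum_mul]
  refine (measureReal_biUnion_finset_le _ _).trans (Finset.sum_le_sum fun n _ => ?_)
  rw [Finset.sum_mul]
  refine (measureReal_biUnion_finset_le _ _).trans (Finset.sum_le_sum fun k _ => ?_)
  rw [h.measureReal_two_jumps, mul_assoc]
  refine (jointTail_mono_left (fun z hz => hdom n z (hK.trans hz)) x).trans ?_
  exact mul_le_mul_of_nonneg_left
    (jointTail_mono_right (fun z hz => hdom k z (hK.trans hz)) x) (ha0 n)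

-- Look at the first time n with S_n > K. If S_n > x - K, a jump event occurs at n; if not, the walk
-- still has to gain more than K between n and the time m at which it is above x.
omit [MeasurableSpace Ω] in
theorem exceedEvent_subset_of_le_half (ξ : ℕ → Ω → ℝ) (N : ℕ∞) (n₀ : ℕ) {K x : ℝ} (hK : 0 < K)
    (hKx : K ≤ x / 2) :
    exceedEvent ξ N x ⊆ (exceedEvent ξ N x ∩ someJumpEvent ξ N K (x - K)) ∪
      (twoJumpEvent ξ n₀ K x ∪ {ω | ∃ n, n₀ < n ∧ x < walk ξ n ω}) := by
  classical
  intro ω hω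
  obtain ⟨m, hmN, hm⟩ := mem_exceedEvent.1 hω
  by_cases hmn : n₀ < m
  · exact .inr (.inr ⟨m, hmn, hm⟩)
  have hex : ∃ n, K < walk ξ n ω := ⟨m, by linarith⟩
  let n := Nat.find hex
  have hn : K < walk ξ n ω := Nat.find_spec hex
  have hnm : n ≤ m := Nat.find_min' hex (by linarith)
  have hn0 : n ≠ 0 := by
    intro h0
    rw [h0, walk_zero] at hn
    linarith
  have hmin : ∀ k ≤ n - 1, walk ξ k ω ≤ K := fun k hk =>
    not_lt.1 (Nat.find_min hex (m := k) (by change k < n; omega))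
  by_cases hj : x - K < walk ξ n ω
  · refine .inl ⟨hω, Set.mem_iUnion₂.2 ⟨n, ⟨Nat.one_le_iff_ne_zero.2 hn0, ?_⟩,
      mem_jumpEvent.2 ⟨hmin, hj⟩⟩⟩
    exact (Nat.cast_le.2 hnm).trans hmN
  · refine .inr (.inl ?_)
    simp only [twoJumpEvent, Set.mem_iUnion, Finset.mem_range]
    have hw := walk_add ξ n (m - n) ω
    rw [Nat.add_sub_cancel' hnm] at hw
    refine ⟨n, by omega, m - n, by omega, hn, by linarith, ?_⟩
    rwa [Nat.add_sub_cancel' hnm]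

omit [MeasurableSpace Ω] in
theorem exceedEvent_subset_min (ξ : ℕ → Ω → ℝ) (N : ℕ∞) (n₀ : ℕ) (x : ℝ) :
    exceedEvent ξ N x ⊆ exceedEvent ξ (min N n₀) x ∪ {ω | ∃ n, n₀ < n ∧ x < walk ξ n ω} := by
  intro ω hω
  obtain ⟨m, hmN, hm⟩ := mem_exceedEvent.1 hω
  by_cases hmn : n₀ < m
  · exact .inr ⟨m, hmn, hm⟩
  · exact .inl (mem_exceedEvent.2 ⟨m, le_min hmN (Nat.cast_le.2 (not_lt.1 hmn)), hm⟩)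

theorem IsIID.tendstoUniformly_exceedEvent (h : IsIID P μ ξ) (hS : ClassS γ μ) (hγ : 0 < γ)
    (hφ : expMoment μ γ < 1) :
    TendstoUniformly (fun (x : ℝ) (N : ℕ∞) => P.real (exceedEvent ξ N x) / tail μ x)
      (fun N : ℕ∞ => (limitConst P ξ μ γ N).toReal) atTop := by
  obtain ⟨A, a, -, ha0, ha, hdom⟩ := hS.exists_summable_tail_walkLaw_le hγ hφ
  rw [Metric.tendstoUniformly_iff]
  intro ε hε
  have hε3 : 0 < ε / 3 := by positivity
  have hmono := h.toReal_limitConst_mono hγ hφ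
  have hrem := (tendsto_sum_nat_add a).comp (tendsto_add_atTop_nat 1)
  obtain ⟨n₀, hR, hc⟩ := ((hrem.eventually (gt_mem_nhds hε3)).and
    ((h.tendsto_limitConst hγ hφ).eventually (lt_mem_nhds (sub_lt_self _ hε3)))).exists
  have hfin : ∀ᶠ x in atTop, ∀ k ∈ Finset.range (n₀ + 1),
      |tail (maxLaw μ k) x / tail μ x - (limitConst P ξ μ γ k).toReal| < ε / 3 := by
    rw [eventually_all_finset]
    exact fun k _ => (h.tendsto_tail_maxLaw hS hγ hφ k).eventually (Metric.ball_mem_nhds _ hε3)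
  filter_upwards [hfin, eventually_ge_atTop A] with x hx hxA N
  -- Capping at n₀ reduces all N ≤ ∞ to finitely many horizons; the error is shared between the
  -- fixed-horizon limit, the late times, and c_∞ - c_{n₀}.
  obtain ⟨k, hk⟩ : ∃ k : ℕ, (k : ℕ∞) = min N n₀ :=
    ENat.ne_top_iff_exists.1 (ne_top_of_le_ne_top (ENat.natCast_ne_top n₀) (min_le_right _ _))
  have hkn : k ≤ n₀ := by
    rw [← Nat.cast_le (α := ℕ∞), hk]; exact min_le_right _ _
  have hp := hS.tail_pos x
  have h1 := hx k (Finset.mem_range_succ_iff.2 hkn)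
  rw [← h.measureReal_exceedEvent, hk] at h1
  have h2 : P.real (exceedEvent ξ (min N n₀) x) / tail μ x ≤
      P.real (exceedEvent ξ N x) / tail μ x :=
    div_le_div_of_nonneg_right (measureReal_mono (exceedEvent_mono ξ x (min_le_left _ _))) hp.le
  have h3 : P.real (exceedEvent ξ N x) / tail μ x ≤
      P.real (exceedEvent ξ (min N n₀) x) / tail μ x + ∑' n, a (n + (n₀ + 1)) := by
    rw [div_add' _ _ _ hp.ne']
    refine div_le_div_of_nonneg_right ?_ hp.le
    refine (measureReal_mono (exceedEvent_subset_min ξ N n₀ x)).trans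
      ((measureReal_union_le _ _).trans ?_)
    exact add_le_add_right (h.measureReal_exists_lt_walk_le ha0 ha hdom hxA n₀) _
  have h4 : (limitConst P ξ μ γ (min N n₀)).toReal ≤ (limitConst P ξ μ γ N).toReal :=
    hmono (min_le_left _ _)
  have h5 : (limitConst P ξ μ γ N).toReal ≤
      (limitConst P ξ μ γ (min N n₀)).toReal + ε / 3 := by
    rcases le_total N n₀ with hN | hN
    · rw [min_eq_left hN]; linarith
    · rw [min_eq_right hN]
      have : (limitConst P ξ μ γ N).toReal ≤ (limitConst P ξ μ γ ⊤).toReal := hmono le_top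
      linarith
  have hR' : ∑' n, a (n + (n₀ + 1)) < ε / 3 := hR
  rw [Real.dist_eq]
  rw [abs_lt] at *
  constructor <;> linarith [h1.1, h1.2]

theorem IsIID.tendstoUniformly_exceedEvent_inter (h : IsIID P μ ξ) (hS : ClassS γ μ) (hγ : 0 < γ)
    (hφ : expMoment μ γ < 1) {g : ℝ → ℝ} (hg : IsTruncation g) :
    TendstoUniformly (fun (x : ℝ) (N : ℕ∞) =>
        P.real (exceedEvent ξ N x ∩ someJumpEvent ξ N (g x) (x - g x)) / tail μ x)
      (fun N : ℕ∞ => (limitConst P ξ μ γ N).toReal) atTop := by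
  obtain ⟨A, a, -, ha0, ha, hdom⟩ := hS.exists_summable_tail_walkLaw_le hγ hφ
  have hunif := h.tendstoUniformly_exceedEvent hS hγ hφ
  rw [Metric.tendstoUniformly_iff] at hunif ⊢
  intro ε hε
  have hε3 : 0 < ε / 3 := by positivity
  have hrem := (tendsto_sum_nat_add a).comp (tendsto_add_atTop_nat 1)
  obtain ⟨n₀, hR⟩ := (hrem.eventually (gt_mem_nhds hε3)).exists
  have hR' : ∑' n, a (n + (n₀ + 1)) < ε / 3 := hR
  set B := ∑ n ∈ Finset.range (n₀ + 1), ∑ k ∈ Finset.range (n₀ + 1), a n * a k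
  have hB : 0 ≤ B := Finset.sum_nonneg fun n _ => Finset.sum_nonneg fun k _ =>
    mul_nonneg (ha0 n) (ha0 k)
  obtain ⟨K₀, hK₀⟩ := hS.eventually_jointTail_le (ε := ε / (3 * (B + 1))) (by positivity)
  filter_upwards [hunif _ hε3, hK₀ _ le_rfl, hg.tendsto_atTop.eventually_ge_atTop (max A K₀),
    eventually_gt_atTop 0] with x hx hJ hgx hx0 N
  have hp := hS.tail_pos x
  have hA := (le_max_left _ _).trans hgx
  have hgh := hg.le_half x hx0
  have hg0 := hg.pos x hx0
  have h1 := hx N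
  have h2 : P.real (exceedEvent ξ N x ∩ someJumpEvent ξ N (g x) (x - g x)) / tail μ x ≤
      P.real (exceedEvent ξ N x) / tail μ x :=
    div_le_div_of_nonneg_right (measureReal_mono Set.inter_subset_left) hp.le
  have h3 : P.real (twoJumpEvent ξ n₀ (g x) x) ≤ ε / 3 * tail μ x := by
    -- The level g(x) moves with x, but `jointTail` decreases in its level, so the estimate at the
    -- fixed level K₀ suffices.
    have hJ' := (jointTail_antitone μ μ x ((le_max_right _ _).trans hgx)).trans hJ
    calc _ ≤ B * jointTail μ μ (g x) x := h.measureReal_twoJumpEvent_le ha0 hdom hA x n₀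
      _ ≤ B * (ε / (3 * (B + 1)) * tail μ x) := mul_le_mul_of_nonneg_left hJ' hB
      _ = B / (B + 1) * (ε / 3 * tail μ x) := by field_simp
      _ ≤ 1 * (ε / 3 * tail μ x) := by
        refine mul_le_mul_of_nonneg_right ?_ (by positivity)
        rw [div_le_one (by positivity)]; linarith
      _ = _ := one_mul _
  have h4 : P.real (exceedEvent ξ N x) / tail μ x ≤
      P.real (exceedEvent ξ N x ∩ someJumpEvent ξ N (g x) (x - g x)) / tail μ x +
        (ε / 3 + ∑' n, a (n + (n₀ + 1))) := by
    rw [div_add' _ _ _ hp.ne']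
    refine div_le_div_of_nonneg_right ?_ hp.le
    refine (measureReal_mono (exceedEvent_subset_of_le_half ξ N n₀ hg0 hgh)).trans
      ((measureReal_union_le _ _).trans (add_le_add_right
        ((measureReal_union_le _ _).trans ?_) _))
    rw [add_mul]
    exact add_le_add h3 (h.measureReal_exists_lt_walk_le ha0 ha hdom
      (hA.trans (by linarith)) n₀)
  rw [Real.dist_eq] at h1 ⊢
  rw [abs_lt] at *
  constructor <;> linarith [h1.1, h1.2]

theorem IsIID.toReal_limitConst_top_pos (h : IsIID P μ ξ) (hγ : 0 < γ) (hφ : expMoment μ γ < 1) :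
    0 < (limitConst P ξ μ γ ⊤).toReal := by
  refine ENNReal.toReal_pos ?_ (h.limitConst_top_lt_top hγ hφ).ne
  -- Positivity comes from c_∞ ≥ c_1 ≥ E e^{γ M_0} = 1.
  have h1 : limitConst P ξ μ γ ((0 + 1 : ℕ) : ℕ∞) ≤ limitConst P ξ μ γ ⊤ :=
    limitConst_mono hγ le_top
  rw [limitConst_succ, h.maxExpMoment_coe] at h1
  refine (lt_of_lt_of_le ?_ (le_self_add.trans h1)).ne'
  simp [maxLaw, expMoment]

theorem IsIID.tendsto_cond_exceedEvent (h : IsIID P μ ξ) (hS : ClassS γ μ) (hγ : 0 < γ)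
    (hφ : expMoment μ γ < 1) (N : ℕ∞) :
    Tendsto (fun x : ℝ => (cond P (exceedEvent ξ ⊤ x)).real (exceedEvent ξ N x)) atTop
      (𝓝 ((limitConst P ξ μ γ N).toReal / (limitConst P ξ μ γ ⊤).toReal)) := by
  have hunif := h.tendstoUniformly_exceedEvent hS hγ hφ
  refine ((hunif.tendsto_at N).div (hunif.tendsto_at ⊤)
    (h.toReal_limitConst_top_pos hγ hφ).ne').congr fun x => ?_
  have hp := (hS.tail_pos x).ne'
  rw [Pi.div_apply, div_div_div_cancel_right₀ hp, measureReal_def (cond _ _),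
    cond_apply (measurableSet_exceedEvent h.measurable ⊤ x), ENNReal.toReal_mul,
    ENNReal.toReal_inv, Set.inter_eq_right.2 (exceedEvent_mono ξ x le_top), div_eq_inv_mul]
  rfl

end Limit

end GammaWalk

theorem mainTheorem3 {Ω : Type*} [MeasurableSpace Ω] (P : Measure Ω) [IsProbabilityMeasure P]
    (μ : Measure ℝ) [IsProbabilityMeasure μ] (ξ : ℕ → Ω → ℝ)
    (hξ_meas : ∀ i, Measurable (ξ i)) (hξ_indep : iIndepFun ξ P)
    (hξ_law : ∀ i, P.map (ξ i) = μ)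
    (γ : ℝ) (hγ : 0 < γ) (hS : ClassS γ μ) (hφ : expMoment μ γ < 1) :
    (∀ N : ℕ∞, 1 ≤ N → limitConst P ξ μ γ N < ∞) ∧
    (∀ h : ℝ → ℝ, IsTruncation h →
      TendstoUniformlyOn
        (fun (x : ℝ) (N : ℕ∞) =>
          P.real (exceedEvent ξ N x ∩ someJumpEvent ξ N (h x) (x - h x)) / tail μ x)
        (fun N : ℕ∞ => (limitConst P ξ μ γ N).toReal) atTop {N : ℕ∞ | 1 ≤ N}) ∧
    TendstoUniformlyOn
      (fun (x : ℝ) (N : ℕ∞) => P.real (exceedEvent ξ N x) / tail μ x)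
      (fun N : ℕ∞ => (limitConst P ξ μ γ N).toReal) atTop {N : ℕ∞ | 1 ≤ N} ∧
    (∀ ε : ℝ, 0 < ε → ∃ N : ℕ, 1 ≤ N ∧ ∃ l : ℝ, 1 - ε < l ∧
      Tendsto (fun x : ℝ => (cond P (exceedEvent ξ ⊤ x)).real (exceedEvent ξ N x))
        atTop (𝓝 l)) := by
  have hX : IsIID P μ ξ := ⟨hξ_meas, hξ_indep, hξ_law⟩
  refine ⟨fun N _ => hX.limitConst_lt_top hγ hφ N,
    fun h hh => (hX.tendstoUniformly_exceedEvent_inter hS hγ hφ hh).tendstoUniformlyOn,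
    (hX.tendstoUniformly_exceedEvent hS hγ hφ).tendstoUniformlyOn, fun ε hε => ?_⟩
  have hc := hX.toReal_limitConst_top_pos hγ hφ
  have hlim := (hX.tendsto_limitConst hγ hφ).div_const (limitConst P ξ μ γ ⊤).toReal
  rw [div_self hc.ne'] at hlim
  obtain ⟨N, hN, hN1⟩ := ((hlim.eventually (lt_mem_nhds (sub_lt_self 1 hε))).and
    (eventually_ge_atTop 1)).exists
  exact ⟨N, hN1, _, hN, hX.tendsto_cond_exceedEvent hS hγ hφ N⟩
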